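/- **Conventions.** All information quantities are in nats. Let $F_X$ be a probability distribution on $\mathbb{R}^m$ and $e:\mathbb{R}^m\times\mathbb{R}^m\to[0,\infty)$ a measurable distortion measure. For $D\ge 0$ the distribution preserving rate-distortion function (DP-RDF) is $$R_{\mathrm{DP}}(D)=\inf_{F_{\tilde X|X}\in\mathcal F(D)} I(X;\tilde X)\in[0,\infty],\qquad \mathcal F(D)=\bigl\{F_{\tilde X|X}:\ \mathbb{E}\{e(X,\tilde X)\}\le D,\ F_{\tilde X}=F_X\bigr\},$$ where $X\sim F_X$, $F_{\tilde X|X}$ ranges over conditional distributions (Markov kernels) on $\mathbb{R}^m$, $I$ is mutual information (the Kullback-Leibler divergence of the joint law from the product of the marginals), and $\inf\emptyset=\infty$. A *quantizer ensemble* on a measurable space $A$ is a jointly measurable map $(x,\theta)\mapsto q(x|\theta)\in A$, with $\theta$ in some measurable space, such that each quantizer $q(\cdot|\theta)$ has a countable set of values and is equipped with a uniquely decodable code for these values, over a finite code alphabet of size $b\ge 2$ common to all $\theta$ (if $q(\cdot|\theta)$ has only one value, the empty codeword is also allowed). The quantizer is selected by a random element $\Theta$. The rate $\bar R(\theta)$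 of $q(\cdot|\theta)$ on a given source is $\log b$ times its expected codeword length under the law of the source, and the rate of the ensemble is $R=\mathbb{E}\{\bar R(\Theta)\}$. The ensemble is a *distribution preserving quantization (DPQ)* of the source if $\Theta$ is independent of the source and the reconstruction has the same distribution as the source. **Proposition (DP-RDF is a lower bound for DPQ).** Let $k\ge1$ and let $X_K=(X_1,\dots,X_k)$ be i.i.d. random vectors in $\mathbb{R}^m$ with distribution $F_X$. Let $\tilde X_K=q(X_K|\Theta)$ be any DPQ scheme for $X_K$ (on $A=(\mathbb{R}^m)^k$; in particular $\tilde X_K$ has the same joint distribution as $X_K$), with rate $R\in[0,\infty]$. Consider the single-letter fidelity criterion $$e_k(x_K,\tilde x_K)=k^{-1}\sum_{i=1}^k e(x_i,\tilde x_i).$$ If $D\ge 0$ and $\mathbb{E}\{e_k(X_K,\tilde X_K)\}\le D$, then the per-dimension rate of the scheme satisfies $$k^{-1}R\ \ge\ R_{\mathrm{DP}}(D).$$ -/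

import Mathlib

open MeasureTheory ProbabilityTheory
open scoped ENNReal NNReal

noncomputable section

/-- Mutual information `I(X ; X̃)`, in nats, of a pair with `X ∼ μ` and conditional distribution
`κ` of `X̃` given `X`: the Kullback-Leibler divergence of the joint law from the product of
its two marginals. It takes values in `[0, ∞]`. -/
def mutualInformation {A : Type*} [MeasurableSpace A] (μ : Measure A) (κ : Kernel A A) : ℝ≥0∞ :=
  InformationTheory.klDiv (μ.compProd κ) (μ.prod (μ.bind κ))

/-- The set `𝓕(D)` of conditional distributions of `X̃` given `X ∼ μ` with expected distortion
at most `D` and such that `X̃` has the same distribution as `X`. -/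
def distributionPreservingChannels {A : Type*} [MeasurableSpace A] (μ : Measure A)
    (e : A → A → ℝ≥0) (D : ℝ≥0) : Set (Kernel A A) :=
  {κ | IsMarkovKernel κ ∧ ∫⁻ p, (e p.1 p.2 : ℝ≥0∞) ∂(μ.compProd κ) ≤ D ∧ μ.bind κ = μ}

/-- The distribution preserving rate-distortion function (in nats) of the distribution `μ` and
the distortion measure `e`, with value `∞` where no channel is admissible. -/
def dpRDF {A : Type*} [MeasurableSpace A] (μ : Measure A) (e : A → A → ℝ≥0) (D : ℝ≥0) : ℝ≥0∞ :=
  ⨅ κ ∈ distributionPreservingChannels μ e D, mutualInformation μ κ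

/-- `c` is a uniquely decodable code for the set of symbols `S`: distinct symbols have distinct
codewords and the set of codewords is uniquely decodable. If there is only one symbol, nothing
has to be transmitted and any codeword, also the empty one (length zero), is admitted. -/
def IsUniquelyDecodableCode {A α : Type*} (S : Set A) (c : A → List α) : Prop :=
  Set.InjOn c S ∧ (InformationTheory.UniquelyDecodable (c '' S) ∨ S.Subsingleton)

/-- A quantizer ensemble `q(· | θ)` on `A`, with its quantizers selected by `θ : T`. Every
quantizer has a countable set of values and a uniquely decodable code for these values, with
codewords over the code alphabet `α`. -/
structure QuantizerEnsemble (A T α : Type*) [MeasurableSpace A] [MeasurableSpace T] where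
  quantizer : T → A → A
  measurable_quantizer : Measurable fun p : T × A => quantizer p.1 p.2
  countable_range : ∀ θ, (Set.range (quantizer θ)).Countable
  codeword : T → A → List α
  uniquelyDecodable : ∀ θ, IsUniquelyDecodableCode (Set.range (quantizer θ)) (codeword θ)

namespace QuantizerEnsemble

variable {A T α Ω : Type*} [MeasurableSpace A] [MeasurableSpace T] [MeasurableSpace Ω]

/-- The reconstruction `X̃ = q(X | Θ)`. -/
def reconstruction (q : QuantizerEnsemble A T α) (X : Ω → A) (Θ : Ω → T) : Ω → A :=
  fun ω => q.quantizer (Θ ω) (X ω)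

/-- The ensemble, with selection variable `Θ`, is a distribution preserving quantization of the
source `X`: the selection is independent of the source and the reconstruction has the same
distribution as the source. -/
def IsDPQ (q : QuantizerEnsemble A T α) (P : Measure Ω) (X : Ω → A) (Θ : Ω → T) : Prop :=
  IndepFun X Θ P ∧ P.map (q.reconstruction X Θ) = P.map X

/-- The rate (in nats) of the individual quantizer `q(· | θ)` on a source with law `ν`: its
expected codeword length, where each code letter counts as `log |α|` nats. -/
def quantizerRate [Fintype α] (q : QuantizerEnsemble A T α) (ν : Measure A) (θ : T) : ℝ≥0∞ :=
  ENNReal.ofReal (Real.log (Fintype.card α)) *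
    ∫⁻ x, ((q.codeword θ (q.quantizer θ x)).length : ℝ≥0∞) ∂ν

/-- The rate of the ensemble: the expected rate `E[R̄(Θ)]` of its individual quantizers, where
the source has the law of `X` and the quantizer is selected with the law of `Θ`. -/
def rate [Fintype α] (q : QuantizerEnsemble A T α) (P : Measure Ω) (X : Ω → A) (Θ : Ω → T) :
    ℝ≥0∞ :=
  ∫⁻ θ, q.quantizerRate (P.map X) θ ∂(P.map Θ)

end QuantizerEnsemble

/-- The single-letter fidelity criterion `e_k(x, y) = k⁻¹ ∑ i, e(x_i, y_i)`. -/
def singleLetterFidelity {A : Type*} (e : A → A → ℝ≥0) {k : ℕ} (x y : Fin k → A) : ℝ≥0 :=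
  (k : ℝ≥0)⁻¹ * ∑ i, e (x i) (y i)

end

/-! ### Divergence inequalities: superadditivity, convexity, bounds from an explicit density. -/

section KullbackLeibler

open InformationTheory

/-! Two estimates meet at the mutual information of source and reconstruction. Upper bound by the
rate: keep `Θ`, and compare the law of `(Θ, X, q(X|Θ))` with that of `(Θ, X, q(X'|Θ))`, where `X'`
is an independent copy of `X`. The density is one over the conditional probability of the value
taken, so the divergence is at most the mean entropy of the quantizers, hence at most the rate by
Kraft-McMillan. Forgetting `Θ` only lowers the divergence and turns the reference into the product
of the marginals (`klDiv_map_quantizer_le`). Lower bound by the DP-RDF: average the `k`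
single-letter couplings. Both marginals of the average are `F_X`, because the reconstruction has the
law of the source, and its distortion is that of the block. Convexity (`klDiv_average_le`) bounds
its divergence from `F_X × F_X` by the mean of the single-letter ones. Superadditivity
(`sum_klDiv_map_eval_le_klDiv_pi`) bounds their sum by the block information; it applies because
both blocks are i.i.d., so the reference measure factorizes over letters. -/

theorem klDiv_fst_add_klDiv_snd_le {A B : Type*} [MeasurableSpace A] [MeasurableSpace B]
    [StandardBorelSpace B] [Nonempty B] (P : Measure (A × B)) [IsProbabilityMeasure P]
    (R₁ : Measure A) [IsProbabilityMeasure R₁] (R₂ : Measure B) [IsProbabilityMeasure R₂] :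
    klDiv P.fst R₁ + klDiv P.snd R₂ ≤ klDiv P (R₁.prod R₂) := by
  have hP : P = P.fst.compProd P.condKernel := (P.disintegrate P.condKernel).symm
  have key : klDiv P (R₁.prod R₂) = klDiv P.fst R₁ + klDiv P (P.fst.prod R₂) := by
    -- Chain rule against the constant kernel `R₂`; data processing under the second projection then
    -- handles the remaining term.
    have h := klDiv_compProd_eq_add P.fst R₁ P.condKernel (Kernel.const A R₂)
    rwa [← hP, Measure.compProd_const, Measure.compProd_const] at h
  rw [key]
  gcongr
  have h := klDiv_map_le P (P.fst.prod R₂) measurable_snd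
  have h2 : (P.fst.prod R₂).map Prod.snd = R₂ := by
    rw [Measure.map_snd_prod]; simp
  rwa [h2] at h

/-- Superadditivity of the Kullback-Leibler divergence from a product measure. -/
theorem sum_klDiv_map_eval_le_klDiv_pi {A : Type*} [MeasurableSpace A] [StandardBorelSpace A]
    [Nonempty A] (R : Measure A) [IsProbabilityMeasure R] {n : ℕ} (P : Measure (Fin n → A))
    [IsProbabilityMeasure P] :
    ∑ i, klDiv (P.map fun x => x i) R ≤ klDiv P (Measure.pi fun _ => R) := by
  induction n with
  | zero => simp
  | succ n ih =>
    let φ := MeasurableEquiv.piFinSuccAbove (fun _ : Fin (n + 1) => A) 0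
    have hφ : (Measure.pi fun _ => R).map φ = R.prod (Measure.pi fun _ : Fin n => R) :=
      (measurePreserving_piFinSuccAbove (fun _ : Fin (n + 1) => R) 0).map_eq
    have : IsProbabilityMeasure (P.map φ) :=
      Measure.isProbabilityMeasure_map φ.measurable.aemeasurable
    have hfst : (P.map φ).fst = P.map fun x => x 0 := by
      rw [Measure.fst, Measure.map_map measurable_fst φ.measurable]; rfl
    have hsnd (i : Fin n) : (P.map φ).snd.map (fun x => x i) = P.map fun x => x i.succ := by
      rw [Measure.snd, Measure.map_map measurable_snd φ.measurable,
        Measure.map_map (measurable_pi_apply i) (measurable_snd.comp φ.measurable)]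
      rfl
    rw [Fin.sum_univ_succ]
    calc _ ≤ klDiv (P.map φ).fst R + klDiv (P.map φ).snd (Measure.pi fun _ => R) := by
          rw [hfst]
          gcongr
          simpa only [hsnd] using ih (P.map φ).snd
      _ ≤ klDiv (P.map φ) (R.prod (Measure.pi fun _ => R)) := klDiv_fst_add_klDiv_snd_le _ _ _
      _ ≤ _ := by
          rw [← hφ]
          exact klDiv_map_le _ _ φ.measurable

/-- Convexity of the Kullback-Leibler divergence in its first argument, for uniform weights. -/
theorem klDiv_average_le {A : Type*} [MeasurableSpace A] (R : Measure A) [IsFiniteMeasure R]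
    {k : ℕ} (hk : 0 < k) (Q : Fin k → Measure A) [∀ i, IsFiniteMeasure (Q i)] :
    klDiv ((k : ℝ≥0∞)⁻¹ • ∑ i, Q i) R ≤ (k : ℝ≥0∞)⁻¹ * ∑ i, klDiv (Q i) R := by
  have hk0 : (k : ℝ≥0∞)⁻¹ ≠ 0 := by simp
  have hkt : (k : ℝ≥0∞)⁻¹ ≠ ∞ := by simp [hk.ne']
  by_cases hac : ∀ i, Q i ≪ R
  swap
  · push Not at hac
    obtain ⟨i, hi⟩ := hac
    have : ∑ i, klDiv (Q i) R = ∞ :=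
      ENNReal.sum_eq_top.2 ⟨i, Finset.mem_univ _, klDiv_of_not_ac hi⟩
    rw [this, ENNReal.mul_top hk0]
    exact le_top
  let f : A → ℝ≥0∞ := fun x => (k : ℝ≥0∞)⁻¹ * ∑ i, (Q i).rnDeriv R x
  have hf : Measurable f := by fun_prop
  have hQ : (k : ℝ≥0∞)⁻¹ • ∑ i, Q i = R.withDensity f := by
    ext s hs
    rw [withDensity_apply _ hs, lintegral_const_mul _ (by fun_prop),
      lintegral_finsetSum _ (by fun_prop)]
    simp only [Measure.smul_apply, Measure.finsetSum_apply, smul_eq_mul]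
    congr 1
    exact Finset.sum_congr rfl fun i _ => (Measure.setLIntegral_rnDeriv (hac i) s).symm
  have hac' : R.withDensity f ≪ R := withDensity_absolutelyContinuous _ _
  have : IsFiniteMeasure (R.withDensity f) := by
    rw [← hQ]
    refine ⟨?_⟩
    rw [Measure.smul_apply, smul_eq_mul]
    exact ENNReal.mul_lt_top hkt.lt_top (measure_lt_top _ _)
  rw [hQ, klDiv_eq_lintegral_klFun_of_ac hac']
  simp_rw [klDiv_eq_lintegral_klFun_of_ac (hac _)]
  rw [← lintegral_finsetSum _ (by fun_prop), ← lintegral_const_mul _ (by fun_prop)]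
  refine lintegral_mono_ae ?_
  filter_upwards [Measure.rnDeriv_withDensity R hf,
    ae_all_iff.2 fun i => (Q i).rnDeriv_lt_top R] with x hx hlt
  rw [hx]
  -- Jensen for `klFun`, pointwise on the densities, which are finite almost everywhere.
  have hconv := convexOn_klFun.map_sum_le (t := Finset.univ) (w := fun _ : Fin k => (k : ℝ)⁻¹)
    (p := fun i => ((Q i).rnDeriv R x).toReal) (fun _ _ => by positivity)
    (by simp [hk.ne']) (fun _ _ => ENNReal.toReal_nonneg)
  simp only [smul_eq_mul, ← Finset.mul_sum] at hconv
  have hfx : (f x).toReal = (k : ℝ)⁻¹ * ∑ i, ((Q i).rnDeriv R x).toReal := by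
    simp only [f]
    rw [ENNReal.toReal_mul, ENNReal.toReal_sum fun i _ => (hlt i).ne]
    simp
  rw [hfx]
  refine (ENNReal.ofReal_le_ofReal hconv).trans_eq ?_
  rw [ENNReal.ofReal_mul (by positivity), ENNReal.ofReal_inv_of_pos (by positivity),
    ENNReal.ofReal_natCast, ENNReal.ofReal_sum_of_nonneg]
  exact fun i _ => klFun_nonneg ENNReal.toReal_nonneg

theorem klDiv_withDensity_le_lintegral_log {A : Type*} [MeasurableSpace A] (M : Measure A)
    [IsProbabilityMeasure M] {f : A → ℝ≥0∞} (hf : Measurable f)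
    [IsProbabilityMeasure (M.withDensity f)]
    (h0 : ∀ᵐ x ∂M.withDensity f, 0 ≤ Real.log (f x).toReal) :
    klDiv (M.withDensity f) M ≤
      ∫⁻ x, ENNReal.ofReal (Real.log (f x).toReal) ∂M.withDensity f := by
  have hac : M.withDensity f ≪ M := withDensity_absolutelyContinuous _ _
  have hllr : llr (M.withDensity f) M =ᵐ[M.withDensity f] fun x => Real.log (f x).toReal := by
    filter_upwards [hac.ae_le (Measure.rnDeriv_withDensity M hf)] with x hx
    rw [llr, hx]
  have hmeas : AEStronglyMeasurable (fun x => Real.log (f x).toReal) (M.withDensity f) :=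
    Measurable.aestronglyMeasurable (by fun_prop)
  -- Both measures have mass one, so the mass correction in `klDiv` vanishes. Without integrability
  -- the right side is `∞`, since the logarithm is nonnegative.
  by_cases hint : Integrable (fun x => Real.log (f x).toReal) (M.withDensity f)
  · rw [klDiv_of_ac_of_integrable hac (hint.congr hllr.symm), integral_congr_ae hllr,
      ← ofReal_integral_eq_lintegral_ofReal hint h0]
    simp
  · have := (lintegral_ofReal_ne_top_iff_integrable hmeas h0).not.2 hint
    rw [not_not.1 this]
    exact le_top

end KullbackLeibler

/-! ### Entropy and uniquely decodable codes. -/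

section Coding

open InformationTheory

/-- The Kraft-McMillan inequality for a countable family of symbols with distinct codewords. -/
theorem tsum_inv_card_pow_length_le_one {S α : Type*} [Fintype α] [Nonempty α] {c : S → List α}
    (hc : Function.Injective c) (hud : UniquelyDecodable (Set.range c)) :
    ∑' s, ENNReal.ofReal ((1 / Fintype.card α : ℝ) ^ (c s).length) ≤ 1 := by
  classical
  rw [ENNReal.tsum_eq_iSup_sum]
  refine iSup_le fun F => ?_
  have hF : UniquelyDecodable (F.image c : Set (List α)) := by
    have hsub : (F.image c : Set (List α)) ⊆ Set.range c := by
      rw [Finset.coe_image]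
      exact Set.image_subset_range _ _
    exact fun L₁ L₂ h₁ h₂ => hud L₁ L₂ (fun w hw => hsub (h₁ w hw)) fun w hw => hsub (h₂ w hw)
  have h := kraft_mcmillan_inequality hF
  rw [Finset.sum_image fun _ _ _ _ h => hc h] at h
  rw [← ENNReal.ofReal_sum_of_nonneg fun _ _ => by positivity]
  exact ENNReal.ofReal_le_one.2 h

/-- One term of Gibbs' inequality: `log t ≤ t - 1` at `t = b⁻ⁿ / p`, multiplied by `p`. The terms
are arranged to avoid subtraction in `ℝ≥0∞`. -/
theorem ofReal_neg_log_mul_add_le {p : ℝ≥0∞} (hp : p ≤ 1) {b : ℝ} (hb : 1 ≤ b) (n : ℕ) :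
    ENNReal.ofReal (-Real.log p.toReal) * p + p ≤
      ENNReal.ofReal (Real.log b) * n * p + ENNReal.ofReal ((1 / b) ^ n) := by
  have hpt : p ≠ ∞ := (hp.trans_lt ENNReal.one_lt_top).ne
  lift p to ℝ≥0 using hpt
  have hp1 : (p : ℝ) ≤ 1 := by exact_mod_cast hp
  rcases eq_or_ne p 0 with rfl | hp0
  · simp
  have hpp : (0 : ℝ) < p := by positivity
  have hlog : 0 ≤ Real.log b := Real.log_nonneg hb
  have hlp : Real.log p ≤ 0 := Real.log_nonpos hpp.le hp1
  rw [ENNReal.coe_toReal, ← ENNReal.ofReal_coe_nnreal, ← ENNReal.ofReal_natCast,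
    ← ENNReal.ofReal_mul (by linarith), ← ENNReal.ofReal_mul hlog,
    ← ENNReal.ofReal_mul (by positivity), ← ENNReal.ofReal_add (by nlinarith) hpp.le,
    ← ENNReal.ofReal_add (by positivity) (by positivity)]
  refine ENNReal.ofReal_le_ofReal ?_
  have hs : (0 : ℝ) < (1 / b) ^ n := by positivity
  have h := Real.log_le_sub_one_of_pos (div_pos hs hpp)
  rw [Real.log_div hs.ne' hpp.ne', Real.log_pow, one_div, Real.log_inv, ← one_div] at h
  have h' := mul_le_mul_of_nonneg_right h hpp.le
  rw [sub_mul ((1 / b) ^ n / (p : ℝ)), div_mul_cancel₀ _ hpp.ne'] at h'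
  linarith

/-- The entropy of a discrete distribution is at most the rate of any uniquely decodable code. -/
theorem lintegral_neg_log_le_of_uniquelyDecodable {S α : Type*} [MeasurableSpace S] [Countable S]
    [MeasurableSingletonClass S] [Fintype α] [Nontrivial α] (π : Measure S)
    [IsProbabilityMeasure π] {c : S → List α} (hc : Function.Injective c)
    (hud : UniquelyDecodable (Set.range c) ∨ Subsingleton S) :
    ∫⁻ s, ENNReal.ofReal (-Real.log (π {s}).toReal) ∂π ≤
      ENNReal.ofReal (Real.log (Fintype.card α)) * ∫⁻ s, ((c s).length : ℝ≥0∞) ∂π := by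
  rcases hud with hud | hS
  · rw [← lintegral_const_mul _ (measurable_of_countable _), lintegral_countable',
      lintegral_countable']
    have hsum : ∑' s, π {s} = 1 := by
      simpa using (lintegral_countable' (μ := π) fun _ => 1).symm
    -- Add the total mass `1` on both sides: on the left it is `∑ π {s}`, on the right it dominates
    -- the Kraft sum.
    refine (ENNReal.add_le_add_iff_right ENNReal.one_ne_top).1 ?_
    calc _ = ∑' s, (ENNReal.ofReal (-Real.log (π {s}).toReal) * π {s} + π {s}) := by
          rw [ENNReal.tsum_add, hsum]
      _ ≤ ∑' s, (ENNReal.ofReal (Real.log (Fintype.card α)) * (c s).length * π {s} +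
            ENNReal.ofReal ((1 / Fintype.card α : ℝ) ^ (c s).length)) :=
          ENNReal.tsum_le_tsum fun s => ofReal_neg_log_mul_add_le prob_le_one
            (by exact_mod_cast Fintype.card_pos) _
      _ ≤ _ := by
          rw [ENNReal.tsum_add]
          gcongr
          exact tsum_inv_card_pow_length_le_one hc hud
  -- A single symbol has zero entropy, so nothing is asked of its codeword.
  · have (s : S) : π {s} = 1 := by
      have : ({s} : Set S) = Set.univ := Set.eq_univ_of_forall fun t => Subsingleton.elim t s
      rw [this, measure_univ]
    simp [this]

theorem lintegral_neg_log_fiber_le {A B α : Type*} [MeasurableSpace A] [MeasurableSpace B]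
    [MeasurableSingletonClass B] [Fintype α] [Nontrivial α] (ν : Measure A)
    [IsProbabilityMeasure ν] {f : A → B} (hf : Measurable f) (hr : (Set.range f).Countable)
    {c : B → List α} (hc : IsUniquelyDecodableCode (Set.range f) c) :
    ∫⁻ x, ENNReal.ofReal (-Real.log (ν {x' | f x' = f x}).toReal) ∂ν ≤
      ENNReal.ofReal (Real.log (Fintype.card α)) * ∫⁻ x, ((c (f x)).length : ℝ≥0∞) ∂ν := by
  have : Countable (Set.range f) := hr
  let g : A → Set.range f := Set.rangeFactorization f
  have hg : Measurable g := hf.subtype_mk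
  have : IsProbabilityMeasure (ν.map g) := Measure.isProbabilityMeasure_map hg.aemeasurable
  have h := lintegral_neg_log_le_of_uniquelyDecodable (ν.map g)
    (c := fun s : Set.range f => c s) (fun s t hst => Subtype.ext (hc.1 s.2 t.2 hst)) (by
      refine hc.2.imp (fun h => ?_) (fun h => h.coe_sort)
      have : Set.range (fun s : Set.range f => c s) = c '' Set.range f := by
        rw [Set.image_eq_range]
      rwa [this])
  rw [lintegral_map (measurable_of_countable _) hg, lintegral_map (measurable_of_countable _) hg]
    at h
  have hfib (x : A) : ν.map g {g x} = ν {x' | f x' = f x} := by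
    rw [Measure.map_apply hg (measurableSet_singleton _)]
    congr 1
    ext x'
    simp [g, Set.rangeFactorization, Subtype.ext_iff]
  simp only [hfib] at h
  exact h

theorem ae_measure_fiber_ne_zero {A B : Type*} [MeasurableSpace A] (ν : Measure A) {f : A → B}
    (hr : (Set.range f).Countable) : ∀ᵐ x ∂ν, ν {x' | f x' = f x} ≠ 0 := by
  have h : {x | ν {x' | f x' = f x} = 0} ⊆
      ⋃ y ∈ {y ∈ Set.range f | ν {x' | f x' = y} = 0}, {x' | f x' = y} := by
    intro x hx
    simp only [Set.mem_iUnion]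
    exact ⟨f x, ⟨⟨x, rfl⟩, hx⟩, rfl⟩
  rw [ae_iff]
  simp only [not_not]
  refine measure_mono_null h ?_
  exact (measure_biUnion_null_iff (hr.mono fun _ h => h.1)).2 fun y hy => hy.2

end Coding

/-! ### Information through a randomly selected quantizer. -/

section Ensemble

open InformationTheory

variable {A T : Type*} [MeasurableSpace A] [MeasurableSpace T] [MeasurableEq A]

theorem measurable_measure_fiber (ν : Measure A) [IsProbabilityMeasure ν] {f : T × A → A}
    (hf : Measurable f) : Measurable fun z : T × A => ν {x' | f (z.1, x') = f z} := by
  have hs : MeasurableSet {w : (T × A) × A | f (w.1.1, w.2) = f w.1} :=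
    measurableSet_eq_fun (by fun_prop) (by fun_prop)
  exact measurable_measure_prodMk_left hs

/-- Given `(θ, x)`, an independent copy of the source hits the value `f (θ, x)` with the probability
of its fiber. Restricting to this event and dividing by that probability, almost surely nonzero as
the range is countable, leaves a unit mass at `f (θ, x)`. -/
theorem map_eq_withDensity_fiber (τ : Measure T) [IsProbabilityMeasure τ] (ν : Measure A)
    [IsProbabilityMeasure ν] {f : T × A → A} (hf : Measurable f)
    (hr : ∀ θ, (Set.range fun x => f (θ, x)).Countable) :
    (τ.prod ν).map (fun z => (z, f z)) =
      (((τ.prod ν).prod ν).map fun w => (w.1, f (w.1.1, w.2))).withDensity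
        ({v | v.2 = f v.1}.indicator fun v => (ν {x' | f (v.1.1, x') = f v.1})⁻¹) := by
  have hp := measurable_measure_fiber ν hf
  have hE : MeasurableSet {v : (T × A) × A | v.2 = f v.1} :=
    measurableSet_eq_fun (by fun_prop) (by fun_prop)
  have hd : Measurable ({v : (T × A) × A | v.2 = f v.1}.indicator
      fun v => (ν {x' | f (v.1.1, x') = f v.1})⁻¹) :=
    Measurable.indicator (hp.comp measurable_fst).inv hE
  have hφ : Measurable fun w : (T × A) × A => (w.1, f (w.1.1, w.2)) := by fun_prop
  ext B hB
  have hBf : MeasurableSet {z : T × A | (z, f z) ∈ B} :=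
    (by fun_prop : Measurable fun z : T × A => (z, f z)) hB
  rw [Measure.map_apply (by fun_prop) hB, withDensity_apply _ hB, ← lintegral_indicator hB,
    lintegral_map (hd.indicator hB) hφ, lintegral_prod _ (Measurable.aemeasurable (by fun_prop)),
    Set.preimage, ← lintegral_indicator_one hBf]
  refine lintegral_congr_ae ?_
  have hne : ∀ᵐ z ∂τ.prod ν, ν {x' | f (z.1, x') = f z} ≠ 0 := by
    rw [Measure.ae_prod_iff_ae_ae]
    · exact ae_of_all _ fun θ => ae_measure_fiber_ne_zero ν (hr θ)
    · exact hp (measurableSet_singleton 0).compl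
  filter_upwards [hne] with z hz
  have hfib : MeasurableSet {x' | f (z.1, x') = f z} :=
    measurableSet_eq_fun (by fun_prop) measurable_const
  have : (fun x' => B.indicator ({v : (T × A) × A | v.2 = f v.1}.indicator
      fun v => (ν {x' | f (v.1.1, x') = f v.1})⁻¹) (z, f (z.1, x'))) =
      {x' | f (z.1, x') = f z}.indicator fun _ =>
        {z : T × A | (z, f z) ∈ B}.indicator 1 z * (ν {x' | f (z.1, x') = f z})⁻¹ := by
    ext x'
    by_cases h : f (z.1, x') = f z
    · by_cases hb : (z, f z) ∈ B <;> simp [Set.indicator, h, hb]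
    · simp [Set.indicator, h]
  simp only [this]
  rw [lintegral_indicator_const hfib, mul_assoc, ENNReal.inv_mul_cancel hz (measure_ne_top _ _),
    mul_one]

theorem klDiv_map_quantizer_le (τ : Measure T) [IsProbabilityMeasure τ] (ν : Measure A)
    [IsProbabilityMeasure ν] {f : T × A → A} (hf : Measurable f)
    (hr : ∀ θ, (Set.range fun x => f (θ, x)).Countable) :
    klDiv ((τ.prod ν).map fun z => (z.2, f z)) (ν.prod ((τ.prod ν).map f)) ≤
      ∫⁻ θ, ∫⁻ x, ENNReal.ofReal (-Real.log (ν {x' | f (θ, x') = f (θ, x)}).toReal) ∂ν ∂τ := by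
  have hp := measurable_measure_fiber ν hf
  have hE : MeasurableSet {v : (T × A) × A | v.2 = f v.1} :=
    measurableSet_eq_fun (by fun_prop) (by fun_prop)
  set d : (T × A) × A → ℝ≥0∞ := {v : (T × A) × A | v.2 = f v.1}.indicator
      fun v => (ν {x' | f (v.1.1, x') = f v.1})⁻¹ with hd_def
  have hd : Measurable d := Measurable.indicator (hp.comp measurable_fst).inv hE
  have hψ : Measurable fun z : T × A => (z, f z) := by fun_prop
  have hφ : Measurable fun w : (T × A) × A => (w.1, f (w.1.1, w.2)) := by fun_prop
  have hπ : Measurable fun v : (T × A) × A => (v.1.2, v.2) := by fun_prop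
  set M := ((τ.prod ν).prod ν).map fun w => (w.1, f (w.1.1, w.2)) with hM
  have hMd : (τ.prod ν).map (fun z => (z, f z)) = M.withDensity d :=
    map_eq_withDensity_fiber τ ν hf hr
  have : IsProbabilityMeasure M := Measure.isProbabilityMeasure_map hφ.aemeasurable
  have : IsProbabilityMeasure (M.withDensity d) :=
    hMd ▸ Measure.isProbabilityMeasure_map hψ.aemeasurable
  have hlog (z : T × A) : Real.log (d (z, f z)).toReal =
      -Real.log (ν {x' | f (z.1, x') = f z}).toReal := by
    simp [hd_def, ENNReal.toReal_inv, Real.log_inv]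
  have hlm : Measurable fun v => Real.log (d v).toReal := by fun_prop
  have hkl := klDiv_withDensity_le_lintegral_log M hd (by
    rw [← hMd, ae_map_iff hψ.aemeasurable (measurableSet_le measurable_const hlm)]
    refine ae_of_all _ fun z => ?_
    rw [hlog, neg_nonneg]
    exact Real.log_nonpos ENNReal.toReal_nonneg (ENNReal.toReal_mono ENNReal.one_ne_top prob_le_one))
  rw [← hMd, lintegral_map hlm.ennreal_ofReal hψ] at hkl
  simp only [hlog] at hkl
  have hent : Measurable fun z : T × A =>
      ENNReal.ofReal (-Real.log (ν {x' | f (z.1, x') = f z}).toReal) :=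
    hp.ennreal_toReal.log.neg.ennreal_ofReal
  rw [lintegral_prod _ hent.aemeasurable] at hkl
  refine le_trans ?_ hkl
  have h1 : (τ.prod ν).map (fun z => (z.2, f z)) =
      ((τ.prod ν).map (fun z => (z, f z))).map fun v => (v.1.2, v.2) := by
    rw [Measure.map_map hπ hψ]; rfl
  -- Under `M` the last coordinate depends only on `θ` and the copy, both independent of `x`;
  -- dropping `θ` therefore leaves a product.
  have h2 : ν.prod ((τ.prod ν).map f) = M.map fun v => (v.1.2, v.2) := by
    rw [hM, Measure.map_map hπ hφ]
    have hc : ν.prod ((τ.prod ν).map f) = (ν.prod (τ.prod ν)).map (Prod.map id f) := by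
      rw [← Measure.map_prod_map _ _ measurable_id hf, Measure.map_id]
    have hperm : ν.prod (τ.prod ν) =
        ((τ.prod ν).prod ν).map fun w => (w.1.2, (w.1.1, w.2)) := by
      have hs : (ν.prod τ).prod ν = ((τ.prod ν).prod ν).map (Prod.map Prod.swap id) := by
        rw [← Measure.map_prod_map _ _ measurable_swap measurable_id, Measure.prod_swap,
          Measure.map_id]
      rw [← Measure.prodAssoc_prod, hs,
        Measure.map_map (MeasurableEquiv.measurable _) (by fun_prop)]
      rfl
    rw [hc, hperm, Measure.map_map (by fun_prop) (by fun_prop)]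
    rfl
  rw [h1, h2]
  exact klDiv_map_le _ _ hπ

end Ensemble

/-! ### Single-letterization and the rate bound. -/

section RateDistortion

open InformationTheory

/-- Disintegrating the coupling gives an admissible channel, so couplings can replace kernels and be
averaged directly. -/
theorem dpRDF_le_klDiv_of_coupling {E : Type*} [MeasurableSpace E] [StandardBorelSpace E]
    [Nonempty E] {μ : Measure E} [SFinite μ] {e : E → E → ℝ≥0} {D : ℝ≥0} (Q : Measure (E × E))
    [IsProbabilityMeasure Q] (hfst : Q.fst = μ) (hsnd : Q.snd = μ)
    (hD : ∫⁻ p, (e p.1 p.2 : ℝ≥0∞) ∂Q ≤ D) : dpRDF μ e D ≤ klDiv Q (μ.prod μ) := by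
  have hQ : μ.compProd Q.condKernel = Q := hfst ▸ Q.disintegrate Q.condKernel
  have hbind : μ.bind Q.condKernel = μ := by
    have := Measure.snd_compProd μ Q.condKernel
    rwa [hQ, hsnd, eq_comm] at this
  refine (iInf₂_le Q.condKernel ⟨inferInstance, by rwa [hQ], hbind⟩).trans_eq ?_
  rw [mutualInformation, hbind, hQ]

theorem map_pair_prod_pi {E : Type*} [MeasurableSpace E] (μ : Measure E)
    [IsProbabilityMeasure μ] (k : ℕ) :
    ((Measure.pi fun _ : Fin k => μ).prod (Measure.pi fun _ => μ)).map
      (fun p i => (p.1 i, p.2 i)) = Measure.pi fun _ => μ.prod μ := by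
  have h := (measurePreserving_arrowProdEquivProdArrow E E (Fin k) (fun _ => μ)
    (fun _ => μ)).symm.map_eq
  exact h

theorem dpRDF_le_inv_mul_klDiv {Ω E : Type*} [MeasurableSpace Ω] [MeasurableSpace E]
    [StandardBorelSpace E] (P : Measure Ω) [IsProbabilityMeasure P] {k : ℕ}
    (hk : 0 < k) {μ : Measure E} [IsProbabilityMeasure μ] {e : E → E → ℝ≥0}
    (he : Measurable (Function.uncurry e)) {D : ℝ≥0} {X Y : Ω → Fin k → E}
    (hX : Measurable X) (hY : Measurable Y) (hX_law : P.map X = Measure.pi fun _ => μ)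
    (hY_law : P.map Y = Measure.pi fun _ => μ)
    (hD : ∫⁻ ω, (singleLetterFidelity e (X ω) (Y ω) : ℝ≥0∞) ∂P ≤ D) :
    dpRDF μ e D ≤ (k : ℝ≥0∞)⁻¹ *
      klDiv (P.map fun ω => (X ω, Y ω)) ((P.map X).prod (P.map Y)) := by
  have : Nonempty E := nonempty_of_isProbabilityMeasure μ
  have hk0 : (k : ℝ≥0∞) ≠ 0 := by exact_mod_cast hk.ne'
  have hcancel : (k : ℝ≥0∞)⁻¹ * k = 1 := ENNReal.inv_mul_cancel hk0 (ENNReal.natCast_ne_top k)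
  have hXY (i : Fin k) : Measurable fun ω => (X ω i, Y ω i) := by fun_prop
  let Q : Fin k → Measure (E × E) := fun i => P.map fun ω => (X ω i, Y ω i)
  have hQi (i : Fin k) : IsProbabilityMeasure (Q i) :=
    Measure.isProbabilityMeasure_map (hXY i).aemeasurable
  have hmarg {Z : Ω → Fin k → E} (hZ : Measurable Z)
      (hZ_law : P.map Z = Measure.pi fun _ => μ) (i : Fin k) : P.map (fun ω => Z ω i) = μ := by
    have h := (measurePreserving_eval (fun _ : Fin k => μ) i).map_eq
    rwa [← hZ_law, Measure.map_map (measurable_pi_apply i) hZ] at h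
  have hfst (i : Fin k) : (Q i).map Prod.fst = μ := by
    rw [Measure.map_map measurable_fst (hXY i)]
    exact hmarg hX hX_law i
  have hsnd (i : Fin k) : (Q i).map Prod.snd = μ := by
    rw [Measure.map_map measurable_snd (hXY i)]
    exact hmarg hY hY_law i
  have hmap {g : E × E → E} (hg : Measurable g) (h : ∀ i, (Q i).map g = μ) :
      ((k : ℝ≥0∞)⁻¹ • ∑ i, Q i).map g = μ := by
    rw [Measure.map_smul, ← Measure.mapₗ_apply_of_measurable hg, map_sum]
    simp only [Measure.mapₗ_apply_of_measurable hg, h, Finset.sum_const, Finset.card_univ,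
      Fintype.card_fin, ← Nat.cast_smul_eq_nsmul ℝ≥0∞, smul_smul, hcancel, one_smul]
  have hQ : IsProbabilityMeasure ((k : ℝ≥0∞)⁻¹ • ∑ i, Q i) := by
    refine ⟨?_⟩
    simp [hcancel]
  have hpair : Measurable fun (p : (Fin k → E) × (Fin k → E)) (i : Fin k) => (p.1 i, p.2 i) := by
    fun_prop
  have hXYm : Measurable fun ω => (X ω, Y ω) := by fun_prop
  have hdist : ∫⁻ p, (e p.1 p.2 : ℝ≥0∞) ∂((k : ℝ≥0∞)⁻¹ • ∑ i, Q i) ≤ D := by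
    have hem : Measurable fun p : E × E => (e p.1 p.2 : ℝ≥0∞) := he.coe_nnreal_ennreal
    rw [lintegral_smul_measure, lintegral_finsetSum_measure]
    simp only [Q, lintegral_map hem (hXY _)]
    have hei (i : Fin k) : Measurable fun ω => (e (X ω i) (Y ω i) : ℝ≥0∞) := hem.comp (hXY i)
    rw [← lintegral_finsetSum _ fun i _ => hei i, smul_eq_mul,
      ← lintegral_const_mul _ (Finset.measurable_fun_sum _ fun i _ => hei i)]
    refine (lintegral_congr fun ω => ?_).trans_le hD
    rw [singleLetterFidelity, ENNReal.coe_mul, ENNReal.coe_inv (by exact_mod_cast hk.ne')]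
    push_cast
    rfl
  refine (dpRDF_le_klDiv_of_coupling _ (hmap measurable_fst hfst) (hmap measurable_snd hsnd)
    hdist).trans ((klDiv_average_le _ hk Q).trans ?_)
  gcongr
  have hlaw (i : Fin k) :
      ((P.map fun ω => (X ω, Y ω)).map fun p i => (p.1 i, p.2 i)).map (fun x => x i) = Q i := by
    rw [Measure.map_map hpair hXYm, Measure.map_map (measurable_pi_apply i) (hpair.comp hXYm)]
    rfl
  have : IsProbabilityMeasure (P.map fun ω => (X ω, Y ω)) :=
    Measure.isProbabilityMeasure_map hXYm.aemeasurable
  have : IsProbabilityMeasure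
      ((P.map fun ω => (X ω, Y ω)).map fun p (i : Fin k) => (p.1 i, p.2 i)) :=
    Measure.isProbabilityMeasure_map hpair.aemeasurable
  have h := sum_klDiv_map_eval_le_klDiv_pi (μ.prod μ)
    ((P.map fun ω => (X ω, Y ω)).map fun p (i : Fin k) => (p.1 i, p.2 i))
  simp only [hlaw] at h
  refine h.trans ?_
  -- Both marginals being product measures, regrouping the coordinates letter by letter turns the
  -- reference into a power of `μ.prod μ`.
  rw [hX_law, hY_law, ← map_pair_prod_pi]
  exact klDiv_map_le _ _ hpair

/-- The rate of an ensemble bounds the information that its reconstruction carries about an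
independent source. -/
theorem klDiv_reconstruction_le_rate {Ω T A α : Type*} [MeasurableSpace Ω] [MeasurableSpace T]
    [MeasurableSpace A] [MeasurableEq A] [MeasurableSingletonClass A] [Fintype α] [Nontrivial α]
    (P : Measure Ω) [IsProbabilityMeasure P] {X : Ω → A} (hX : Measurable X) {Θ : Ω → T}
    (hΘ : Measurable Θ) (q : QuantizerEnsemble A T α) (hind : IndepFun X Θ P) :
    klDiv (P.map fun ω => (X ω, q.reconstruction X Θ ω))
      ((P.map X).prod (P.map (q.reconstruction X Θ))) ≤ q.rate P X Θ := by
  have hτ : IsProbabilityMeasure (P.map Θ) := Measure.isProbabilityMeasure_map hΘ.aemeasurable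
  have hν : IsProbabilityMeasure (P.map X) := Measure.isProbabilityMeasure_map hX.aemeasurable
  have hf := q.measurable_quantizer
  have hjoint : P.map (fun ω => (Θ ω, X ω)) = (P.map Θ).prod (P.map X) :=
    (indepFun_iff_map_prod_eq_prod_map_map hΘ.aemeasurable hX.aemeasurable).1 hind.symm
  have h := klDiv_map_quantizer_le (P.map Θ) (P.map X) hf q.countable_range
  rw [← hjoint, Measure.map_map (by fun_prop) (by fun_prop), Measure.map_map hf (by fun_prop)] at h
  refine h.trans (lintegral_mono fun θ => ?_)
  exact lintegral_neg_log_fiber_le (P.map X) (f := q.quantizer θ)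
    (hf.comp measurable_prodMk_left) (q.countable_range θ) (q.uniquelyDecodable θ)

end RateDistortion

theorem mainTheorem3 {Ω T α : Type*} [MeasurableSpace Ω] [MeasurableSpace T]
    [Fintype α] [Nontrivial α] (P : Measure Ω) [IsProbabilityMeasure P]
    (m k : ℕ) (hk : 0 < k)
    (μ : Measure (EuclideanSpace ℝ (Fin m))) [IsProbabilityMeasure μ]
    (e : EuclideanSpace ℝ (Fin m) → EuclideanSpace ℝ (Fin m) → ℝ≥0)
    (he : Measurable (Function.uncurry e))
    (X : Ω → Fin k → EuclideanSpace ℝ (Fin m)) (hX : Measurable X)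
    (hX_law : ∀ i, P.map (fun ω => X ω i) = μ)
    (hX_indep : iIndepFun (fun i ω => X ω i) P)
    (Θ : Ω → T) (hΘ : Measurable Θ)
    (q : QuantizerEnsemble (Fin k → EuclideanSpace ℝ (Fin m)) T α)
    (hq : q.IsDPQ P X Θ)
    (D : ℝ≥0)
    (hD : ∫⁻ ω, (singleLetterFidelity e (X ω) (q.reconstruction X Θ ω) : ℝ≥0∞) ∂P ≤ D) :
    dpRDF μ e D ≤ (k : ℝ≥0∞)⁻¹ * q.rate P X Θ := by
  have hf := q.measurable_quantizer
  have hY : Measurable (q.reconstruction X Θ) := hf.comp (hΘ.prodMk hX)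
  have hXpi : P.map X = Measure.pi fun _ => μ := by
    have h := (iIndepFun_iff_map_fun_eq_pi_map
      fun i => ((measurable_pi_apply i).comp hX).aemeasurable).1 hX_indep
    simp only [Function.comp_def, hX_law] at h
    exact h
  refine (dpRDF_le_inv_mul_klDiv P hk he hX hY hXpi (hq.2.trans hXpi) hD).trans ?_
  gcongr
  exact klDiv_reconstruction_le_rate P hX hΘ q hq.1
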